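/- Let $\mathsf{Brw}$ be the type of Brouwer trees: the set $\mathsf{Brw}$ and the relation $\le$ on it are generated simultaneously (as a quotient inductive-inductive type, i.e. as the initial structure of this kind). Writing $x<y$ for $\mathsf{succ}\,x\le y$, the constructors of $\mathsf{Brw}$ are $\mathsf{zero}$; $\mathsf{succ}\,x$ for $x\in\mathsf{Brw}$; $\mathsf{limit}\,f$ for every sequence $f:\mathbb N\to\mathsf{Brw}$ with $f(k)<f(k+1)$ for all $k$; and the identification $\mathsf{limit}\,f=\mathsf{limit}\,g$ whenever $f$ and $g$ are bisimilar, i.e. $\forall k\,\exists n\; f(k)\le g(n)$ and $\forall k\,\exists n\; g(k)\le f(n)$. The relation $\le$ is generated by: $\mathsf{zero}\le x$; transitivity; $x\le y$ implies $\mathsf{succ}\,x\le\mathsf{succ}\,y$; $x\le f(k)$ for some $k$ implies $x\le\mathsf{limit}\,f$; and $f(k)\le x$ for all $k$ implies $\mathsf{limit}\,f\le x$. Then: (1) $\le$ is antisymmetric: if $x\le y$ and $y\le x$ then $x=y$. (2) $<$ is extensional: if $z<x\leftrightarrow z<y$ for all $z\in\mathsf{Brw}$, then $x=y$. (3) $<$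 is well-founded: every element of $\mathsf{Brw}$ is accessible with respect to $<$. (4) $(\mathsf{Brw},<,\le)$ satisfies the axioms (A1) $<$ is transitive and irreflexive; (A2) $\le$ is reflexive, transitive and antisymmetric; (A3) $x<y$ implies $x\le y$, and $x<y$, $y\le z$ imply $x<z$. Moreover, $x\le y$ and $y<z$ imply $x<z$. -/

import Mathlib

universe u

/-! ## Sequences -/

/-- `IncSeq r` is the type of sequences `ℕ → A` that are increasing with respect to `r`. -/
def IncSeq {A : Type u} (r : A → A → Prop) : Type u :=
  {f : ℕ → A // ∀ k, r (f k) (f (k + 1))}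

/-- `f` is simulated by `g` with respect to `r`. -/
def Simulated {A : Type u} (r : A → A → Prop) (f g : ℕ → A) : Prop :=
  ∀ k, ∃ n, r (f k) (g n)

/-- `f` and `g` are bisimilar with respect to `r`. -/
def Bisimilar {A : Type u} (r : A → A → Prop) (f g : ℕ → A) : Prop :=
  Simulated r f g ∧ Simulated r g f

/-! ## The abstract axioms on a triple `(A, <, ≤)` -/

/-- The three basic assumptions on a type with two relations `<` and `≤`. -/
structure OrdinalAxioms {A : Type u} (lt le : A → A → Prop) : Prop where
  /-- first assumption: `<` is transitive -/
  lt_trans : ∀ x y z, lt x y → lt y z → lt x z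
  /-- first assumption: `<` is irreflexive -/
  lt_irrefl : ∀ x, ¬ lt x x
  /-- second assumption: `≤` is reflexive -/
  le_refl : ∀ x, le x x
  /-- second assumption: `≤` is transitive -/
  le_trans : ∀ x y z, le x y → le y z → le x z
  /-- second assumption: `≤` is antisymmetric -/
  le_antisymm : ∀ x y, le x y → le y x → x = y
  /-- third assumption: `<` is contained in `≤` -/
  le_of_lt : ∀ x y, lt x y → le x y
  /-- third assumption: `x < y` and `y ≤ z` imply `x < z` -/
  lt_of_lt_of_le : ∀ x y z, lt x y → le y z → lt x z

/-- A relation is extensional if elements with the same predecessors are equal. -/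
def ExtensionalRel {A : Type u} (r : A → A → Prop) : Prop :=
  ∀ a b, (∀ c, r c a ↔ r c b) → a = b

/-! ## Brouwer trees

The quotient inductive-inductive type `Brw` is constructed in three steps: raw trees; the
well-formed ones (limits only of strictly increasing sequences), selected simultaneously with the
generation of `≤`; and the quotient by the equality that the `bisim` constructor generates. -/

/-- Raw trees, without any condition on the sequences under a limit. -/
inductive RawTree : Type
  | zero : RawTree
  | succ : RawTree → RawTree
  | limit : (ℕ → RawTree) → RawTree

mutual

/-- Well-formed raw trees: the sequence under every limit is strictly increasing, where
`x < y` means `succ x ≤ y`. -/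
inductive RawTree.Good : RawTree → Prop
  | zero : RawTree.Good RawTree.zero
  | succ {x : RawTree} : RawTree.Good x → RawTree.Good (RawTree.succ x)
  | limit {f : ℕ → RawTree} : (∀ k, RawTree.Good (f k)) →
      (∀ k, RawTree.Le (RawTree.succ (f k)) (f (k + 1))) → RawTree.Good (RawTree.limit f)

/-- The relation `≤`, freely generated by its five constructors on the well-formed trees. -/
inductive RawTree.Le : RawTree → RawTree → Prop
  | zero {x : RawTree} : RawTree.Good x → RawTree.Le RawTree.zero x
  | trans {x y z : RawTree} : RawTree.Le x y → RawTree.Le y z → RawTree.Le x z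
  | succ_mono {x y : RawTree} : RawTree.Le x y → RawTree.Le (RawTree.succ x) (RawTree.succ y)
  | cocone {x : RawTree} {f : ℕ → RawTree} (k : ℕ) : RawTree.Good (RawTree.limit f) →
      RawTree.Le x (f k) → RawTree.Le x (RawTree.limit f)
  | limiting {x : RawTree} {f : ℕ → RawTree} : RawTree.Good (RawTree.limit f) →
      (∀ k, RawTree.Le (f k) x) → RawTree.Le (RawTree.limit f) x

end

/-- Well-formed trees, before quotienting. -/
def PreBrw : Type := {t : RawTree // t.Good}

namespace PreBrw

def le (x y : PreBrw) : Prop := RawTree.Le x.1 y.1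

def zero : PreBrw := ⟨RawTree.zero, RawTree.Good.zero⟩

def succ (x : PreBrw) : PreBrw := ⟨RawTree.succ x.1, RawTree.Good.succ x.2⟩

def lt (x y : PreBrw) : Prop := le (succ x) y

def limit (f : IncSeq lt) : PreBrw :=
  ⟨RawTree.limit (fun k => (f.1 k).1), RawTree.Good.limit (fun k => (f.1 k).2) f.2⟩

/-- The equality generated by `bisim`: the least equivalence relation that is compatible with
`succ` and identifies limits of bisimilar sequences. (Equivalent trees are `≤` each other, hence
pointwise equivalent sequences are bisimilar, and compatibility with `limit` is included.) -/
inductive Eqv : PreBrw → PreBrw → Prop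
  | refl (x : PreBrw) : Eqv x x
  | symm {x y : PreBrw} : Eqv x y → Eqv y x
  | trans {x y z : PreBrw} : Eqv x y → Eqv y z → Eqv x z
  | succ_congr {x y : PreBrw} : Eqv x y → Eqv (succ x) (succ y)
  | bisim (f g : IncSeq lt) : Bisimilar le f.1 g.1 → Eqv (limit f) (limit g)

theorem le_refl (x : PreBrw) : le x x := by
  obtain ⟨t, ht⟩ := x
  change RawTree.Le t t
  induction t with
  | zero => exact RawTree.Le.zero ht
  | succ x ih =>
    cases ht with
    | succ h => exact RawTree.Le.succ_mono (ih h)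
  | limit f ih =>
    have h := ht
    cases ht with
    | limit hf hi =>
      exact RawTree.Le.limiting h (fun k => RawTree.Le.cocone k h (ih k (hf k)))

theorem limit_le_limit {f g : IncSeq lt} (h : Simulated le f.1 g.1) :
    le (limit f) (limit g) :=
  RawTree.Le.limiting (limit f).2 (fun k => by
    obtain ⟨n, hn⟩ := h k
    exact RawTree.Le.cocone n (limit g).2 hn)

theorem Eqv.le_and_ge {x y : PreBrw} (h : Eqv x y) : le x y ∧ le y x := by
  induction h with
  | refl x => exact ⟨le_refl x, le_refl x⟩
  | symm _ ih => exact ⟨ih.2, ih.1⟩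
  | trans _ _ ih₁ ih₂ => exact ⟨RawTree.Le.trans ih₁.1 ih₂.1, RawTree.Le.trans ih₂.2 ih₁.2⟩
  | succ_congr _ ih => exact ⟨RawTree.Le.succ_mono ih.1, RawTree.Le.succ_mono ih.2⟩
  | bisim f g h => exact ⟨limit_le_limit h.1, limit_le_limit h.2⟩

instance setoid : Setoid PreBrw where
  r := Eqv
  iseqv := ⟨Eqv.refl, Eqv.symm, Eqv.trans⟩

end PreBrw

/-- The type of Brouwer trees. -/
def Brw : Type := Quotient PreBrw.setoid

namespace Brw

def mk (x : PreBrw) : Brw := Quotient.mk PreBrw.setoid x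

def le : Brw → Brw → Prop :=
  Quotient.lift₂ PreBrw.le (fun _ _ _ _ h₁ h₂ => propext
    ⟨fun h => RawTree.Le.trans h₁.le_and_ge.2 (RawTree.Le.trans h h₂.le_and_ge.1),
     fun h => RawTree.Le.trans h₁.le_and_ge.1 (RawTree.Le.trans h h₂.le_and_ge.2)⟩)

def zero : Brw := mk PreBrw.zero

def succ : Brw → Brw :=
  Quotient.map PreBrw.succ (fun _ _ h => PreBrw.Eqv.succ_congr h)

instance : LE Brw := ⟨le⟩

/-- `x < y` means `succ x ≤ y`. -/
instance : LT Brw := ⟨fun x y => succ x ≤ y⟩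

/-- A representative of a Brouwer tree. -/
noncomputable def rep (x : Brw) : PreBrw := Quotient.out x

theorem mk_rep (x : Brw) : mk (rep x) = x := Quotient.out_eq x

theorem rep_increasing (f : IncSeq (fun x y : Brw => x < y)) (k : ℕ) :
    PreBrw.lt (rep (f.1 k)) (rep (f.1 (k + 1))) := by
  have h : succ (f.1 k) ≤ f.1 (k + 1) := f.2 k
  rw [← mk_rep (f.1 k), ← mk_rep (f.1 (k + 1))] at h
  exact h

/-- The limit of a strictly increasing sequence of Brouwer trees, computed on representatives. -/
noncomputable def limit (f : IncSeq (fun x y : Brw => x < y)) : Brw :=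
  mk (PreBrw.limit ⟨fun k => rep (f.1 k), rep_increasing f⟩)

/-- On classes of strictly increasing sequences of well-formed trees, `limit` is induced by the
limit of well-formed trees; in particular it does not depend on the representatives. -/
theorem limit_mk (f : IncSeq PreBrw.lt) :
    limit ⟨fun k => mk (f.1 k), f.2⟩ = mk (PreBrw.limit f) := by
  refine Quotient.sound (PreBrw.Eqv.bisim _ _ ⟨fun k => ⟨k, ?_⟩, fun k => ⟨k, ?_⟩⟩)
  · exact (Quotient.mk_out (f.1 k) : PreBrw.Eqv _ _).le_and_ge.1
  · exact (Quotient.mk_out (f.1 k) : PreBrw.Eqv _ _).le_and_ge.2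

end Brw

/-! ## The universal property

Sanity check of the construction: `Brw` with its constructors is the initial algebra of the
signature that specifies the quotient inductive-inductive type. -/

/-- Algebras of the signature of Brouwer trees: point constructors, the constructor `bisim`, and
the constructors of `≤`. -/
structure BrwAlgebra (A : Type u) where
  le : A → A → Prop
  zero : A
  succ : A → A
  limit : IncSeq (fun x y => le (succ x) y) → A
  bisim : ∀ f g : IncSeq (fun x y => le (succ x) y), Bisimilar le f.1 g.1 → limit f = limit g
  le_zero : ∀ x, le zero x
  le_trans : ∀ x y z, le x y → le y z → le x z
  le_succ_mono : ∀ x y, le x y → le (succ x) (succ y)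
  le_cocone : ∀ (x : A) (f : IncSeq (fun x y => le (succ x) y)) (k : ℕ),
    le x (f.1 k) → le x (limit f)
  le_limiting : ∀ (x : A) (f : IncSeq (fun x y => le (succ x) y)),
    (∀ k, le (f.1 k) x) → le (limit f) x

namespace Brw

/-- `Brw` has all the constructors. -/
noncomputable def algebra : BrwAlgebra Brw where
  le := fun x y => x ≤ y
  zero := zero
  succ := succ
  limit := limit
  bisim := by
    intro f g h
    refine Quotient.sound (PreBrw.Eqv.bisim _ _ ⟨fun k => ?_, fun k => ?_⟩)
    · obtain ⟨n, hn⟩ := h.1 k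
      rw [← mk_rep (f.1 k), ← mk_rep (g.1 n)] at hn
      exact ⟨n, hn⟩
    · obtain ⟨n, hn⟩ := h.2 k
      rw [← mk_rep (g.1 k), ← mk_rep (f.1 n)] at hn
      exact ⟨n, hn⟩
  le_zero := by
    rintro ⟨x⟩
    exact RawTree.Le.zero x.2
  le_trans := by
    rintro ⟨x⟩ ⟨y⟩ ⟨z⟩ h₁ h₂
    exact RawTree.Le.trans h₁ h₂
  le_succ_mono := by
    rintro ⟨x⟩ ⟨y⟩ h
    exact RawTree.Le.succ_mono h
  le_cocone := by
    rintro ⟨x⟩ f k h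
    rw [← mk_rep (f.1 k)] at h
    exact RawTree.Le.cocone k (PreBrw.limit ⟨fun k => rep (f.1 k), rep_increasing f⟩).2 h
  le_limiting := by
    rintro ⟨x⟩ f h
    refine RawTree.Le.limiting
      (PreBrw.limit ⟨fun k => rep (f.1 k), rep_increasing f⟩).2 (fun k => ?_)
    have hk := h k
    rw [← mk_rep (f.1 k)] at hk
    exact hk

/-- Induction for propositional families: only the point constructors matter. -/
theorem ind {P : Brw → Prop} (h0 : P zero) (hs : ∀ x, P x → P (succ x))
    (hl : ∀ f : IncSeq (fun x y : Brw => x < y), (∀ k, P (f.1 k)) → P (limit f)) :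
    ∀ x, P x := by
  rintro ⟨t, ht⟩
  change P (mk ⟨t, ht⟩)
  induction t with
  | zero => exact h0
  | succ x ih =>
    cases ht with
    | succ h => exact hs _ (ih h)
  | limit f ih =>
    cases ht with
    | limit hf hi =>
      have h := hl ⟨fun k => mk ⟨f k, hf k⟩, hi⟩ (fun k => ih k (hf k))
      rwa [limit_mk ⟨fun k => ⟨f k, hf k⟩, hi⟩] at h

end Brw

/-- Morphisms from `Brw` to an algebra: maps that preserve `≤` and the point constructors. -/
structure IsBrwHom {A : Type u} (S : BrwAlgebra A) (h : Brw → A) : Prop where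
  map_le : ∀ x y : Brw, x ≤ y → S.le (h x) (h y)
  map_zero : h Brw.zero = S.zero
  map_succ : ∀ x, h (Brw.succ x) = S.succ (h x)
  map_limit : ∀ (f : IncSeq (fun x y : Brw => x < y))
    (hf : ∀ k, S.le (S.succ (h (f.1 k))) (h (f.1 (k + 1)))),
    h (Brw.limit f) = S.limit ⟨fun k => h (f.1 k), hf⟩

open Classical in
/-- Evaluation of raw trees in an algebra; the value at ill-formed trees is irrelevant. -/
noncomputable def RawTree.eval {A : Type u} (S : BrwAlgebra A) : RawTree → A
  | RawTree.zero => S.zero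
  | RawTree.succ x => S.succ (RawTree.eval S x)
  | RawTree.limit f =>
    if h : ∀ k, S.le (S.succ (RawTree.eval S (f k))) (RawTree.eval S (f (k + 1))) then
      S.limit ⟨fun k => RawTree.eval S (f k), h⟩
    else S.zero

theorem RawTree.eval_limit {A : Type u} (S : BrwAlgebra A) {f : ℕ → RawTree}
    (h : ∀ k, S.le (S.succ ((f k).eval S)) ((f (k + 1)).eval S)) :
    (RawTree.limit f).eval S = S.limit ⟨fun k => (f k).eval S, h⟩ := by
  rw [RawTree.eval, dif_pos h]

theorem RawTree.Le.eval {A : Type u} (S : BrwAlgebra A) {x y : RawTree} (h : RawTree.Le x y) :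
    S.le (x.eval S) (y.eval S) := by
  refine RawTree.Le.rec
    (motive_1 := fun t _ => ∀ f, t = RawTree.limit f →
      ∀ k, S.le (S.succ ((f k).eval S)) ((f (k + 1)).eval S))
    (motive_2 := fun x y _ => S.le (x.eval S) (y.eval S))
    ?_ ?_ ?_ ?_ ?_ ?_ ?_ ?_ h
  · intro f hf
    cases hf
  · intro x _ _ f hf
    cases hf
  · intro f _ _ _ ih g hg k
    cases hg
    have := ih k
    rwa [RawTree.eval] at this
  · intro x _ _
    rw [RawTree.eval]
    exact S.le_zero _
  · intro x y z _ _ h₁ h₂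
    exact S.le_trans _ _ _ h₁ h₂
  · intro x y _ h
    rw [RawTree.eval, RawTree.eval]
    exact S.le_succ_mono _ _ h
  · intro x f k _ _ hf h
    rw [RawTree.eval_limit S (hf f rfl)]
    exact S.le_cocone _ _ k h
  · intro x f _ _ hf h
    rw [RawTree.eval_limit S (hf f rfl)]
    exact S.le_limiting _ _ h

theorem PreBrw.eval_limit {A : Type u} (S : BrwAlgebra A) (f : IncSeq PreBrw.lt)
    (h : ∀ k, S.le (S.succ ((f.1 k).1.eval S)) ((f.1 (k + 1)).1.eval S)) :
    (PreBrw.limit f).1.eval S = S.limit ⟨fun k => (f.1 k).1.eval S, h⟩ :=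
  RawTree.eval_limit S h

theorem PreBrw.Eqv.eval {A : Type u} (S : BrwAlgebra A) {x y : PreBrw} (h : PreBrw.Eqv x y) :
    x.1.eval S = y.1.eval S := by
  induction h with
  | refl x => rfl
  | symm _ ih => exact ih.symm
  | trans _ _ ih₁ ih₂ => exact ih₁.trans ih₂
  | succ_congr _ ih =>
    simp only [PreBrw.succ, RawTree.eval]
    rw [ih]
  | bisim f g h =>
    have key : ∀ f : IncSeq PreBrw.lt, ∀ k,
        S.le (S.succ ((f.1 k).1.eval S)) ((f.1 (k + 1)).1.eval S) := by
      intro f k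
      have := RawTree.Le.eval S (f.2 k)
      simpa only [PreBrw.succ, RawTree.eval] using this
    rw [PreBrw.eval_limit S f (key f), PreBrw.eval_limit S g (key g)]
    apply S.bisim
    refine ⟨fun k => ?_, fun k => ?_⟩
    · obtain ⟨n, hn⟩ := h.1 k
      exact ⟨n, RawTree.Le.eval S hn⟩
    · obtain ⟨n, hn⟩ := h.2 k
      exact ⟨n, RawTree.Le.eval S hn⟩

/-- `Brw` is initial: it has exactly one morphism into every algebra. -/
theorem Brw.initial {A : Type u} (S : BrwAlgebra A) : ∃! h : Brw → A, IsBrwHom S h := by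
  let e : Brw → A := Quotient.lift (fun x : PreBrw => x.1.eval S) (fun _ _ h => h.eval S)
  have hrep : ∀ x, (Brw.rep x).1.eval S = e x := fun x => by
    conv_rhs => rw [← Brw.mk_rep x]
    rfl
  refine ⟨e, ⟨?_, ?_, ?_, ?_⟩, ?_⟩
  · rintro ⟨x⟩ ⟨y⟩ h
    exact RawTree.Le.eval S h
  · change RawTree.eval S RawTree.zero = _
    rw [RawTree.eval]
  · rintro ⟨x⟩
    change RawTree.eval S (RawTree.succ x.1) = S.succ (RawTree.eval S x.1)
    rw [RawTree.eval]
  · intro f hf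
    have hf' : ∀ k, S.le (S.succ ((Brw.rep (f.1 k)).1.eval S))
        ((Brw.rep (f.1 (k + 1))).1.eval S) := fun k => by
      rw [hrep, hrep]
      exact hf k
    refine (PreBrw.eval_limit S ⟨fun k => Brw.rep (f.1 k), Brw.rep_increasing f⟩ hf').trans ?_
    congr 1
    exact Subtype.ext (funext fun k => hrep (f.1 k))
  · intro h hh
    have he : ∀ x y : Brw, x ≤ y → S.le (e x) (e y) := by
      rintro ⟨x⟩ ⟨y⟩ h
      exact RawTree.Le.eval S h
    have hes : ∀ x, e (Brw.succ x) = S.succ (e x) := by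
      rintro ⟨x⟩
      change RawTree.eval S (RawTree.succ x.1) = S.succ (RawTree.eval S x.1)
      rw [RawTree.eval]
    funext x
    refine Brw.ind (P := fun x => h x = e x) ?_ ?_ ?_ x
    · rw [hh.map_zero]
      change _ = RawTree.eval S RawTree.zero
      rw [RawTree.eval]
    · intro x hx
      rw [hh.map_succ, hes, hx]
    · intro f hf
      have hi : ∀ k, S.le (S.succ (e (f.1 k))) (e (f.1 (k + 1))) := fun k => by
        rw [← hes]
        exact he _ _ (f.2 k)
      have hi' : ∀ k, S.le (S.succ (h (f.1 k))) (h (f.1 (k + 1))) := fun k => by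
        rw [hf, hf]
        exact hi k
      have hi'' : ∀ k, S.le (S.succ ((Brw.rep (f.1 k)).1.eval S))
          ((Brw.rep (f.1 (k + 1))).1.eval S) := fun k => by
        rw [hrep, hrep]
        exact hi k
      rw [hh.map_limit f hi']
      refine Eq.trans ?_
        (PreBrw.eval_limit S ⟨fun k => Brw.rep (f.1 k), Brw.rep_increasing f⟩ hi'').symm
      congr 1
      exact Subtype.ext (funext fun k => (hf k).trans (hrep (f.1 k)).symm)

-- A tree is determined by the ordinal it denotes, and both relations are comparisons of ordinals.
-- Every constructor of `≤` is valid for ranks (`RawTree.Le.rank_le`); conversely, on well-formed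
-- trees an inequality of ranks can be rebuilt from the constructors (`RawTree.Good.le_of_rank_le`).
-- Since sequences under limits increase strictly, `limit` trees have limit ordinals as ranks. So
-- equal ranks force equal outermost constructors, and two limits of equal rank have bisimilar
-- sequences (`PreBrw.eqv_of_rank_eq`). Hence `Brw.rank` is injective and reflects `≤` and `<`, and
-- all claims are inherited from the ordinals.

-- Ranks of raw trees

/-- The ordinal denoted by a raw tree. -/
noncomputable def RawTree.rank : RawTree → Ordinal.{0}
  | RawTree.zero => 0
  | RawTree.succ x => Order.succ (RawTree.rank x)
  | RawTree.limit f => ⨆ k, RawTree.rank (f k)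

theorem RawTree.rank_le_rank_limit (f : ℕ → RawTree) (k : ℕ) :
    (f k).rank ≤ (RawTree.limit f).rank :=
  Ordinal.le_iSup (fun k => (f k).rank) k

theorem RawTree.rank_limit_le {f : ℕ → RawTree} {a : Ordinal} (h : ∀ k, (f k).rank ≤ a) :
    (RawTree.limit f).rank ≤ a :=
  Ordinal.iSup_le h

theorem RawTree.lt_rank_limit {f : ℕ → RawTree} {a : Ordinal} (h : a < (RawTree.limit f).rank) :
    ∃ k, a < (f k).rank := by
  by_contra! hk
  exact h.not_ge (RawTree.rank_limit_le hk)

theorem RawTree.Le.rank_le {x y : RawTree} (h : RawTree.Le x y) : x.rank ≤ y.rank := by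
  -- Soundness does not depend on well-formedness, so the motive for `Good` is trivial.
  refine RawTree.Le.rec (motive_1 := fun _ _ => True)
    (motive_2 := fun x y _ => x.rank ≤ y.rank)
    trivial (fun _ _ => trivial) (fun _ _ _ _ => trivial) ?_ ?_ ?_ ?_ ?_ h
  · intro x _ _
    exact zero_le
  · intro x y z _ _ h₁ h₂
    exact h₁.trans h₂
  · intro x y _ h
    exact Order.succ_le_succ h
  · intro x f k _ _ _ h
    exact h.trans (RawTree.rank_le_rank_limit f k)
  · intro x f _ _ _ h
    exact RawTree.rank_limit_le h

theorem RawTree.Good.rank_lt_rank_limit {f : ℕ → RawTree} (h : (RawTree.limit f).Good) (k : ℕ) :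
    (f k).rank < (RawTree.limit f).rank := by
  cases h with
  | limit _ hi =>
    exact (Order.succ_le_iff.1 (hi k).rank_le).trans_le (RawTree.rank_le_rank_limit f (k + 1))

theorem RawTree.Good.of_limit {f : ℕ → RawTree} (h : (RawTree.limit f).Good) (k : ℕ) :
    (f k).Good := by
  cases h with
  | limit hf _ => exact hf k

theorem RawTree.Good.of_succ {x : RawTree} (h : (RawTree.succ x).Good) : x.Good := by
  cases h with
  | succ hx => exact hx

theorem RawTree.Good.rank_limit_ne_zero {f : ℕ → RawTree} (h : (RawTree.limit f).Good) :
    (RawTree.limit f).rank ≠ 0 :=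
  (zero_le.trans_lt (h.rank_lt_rank_limit 0)).ne'

/-- If the supremum were `succ a`, some term would exceed `a` and so reach the supremum, which a
strictly increasing sequence never does. -/
theorem RawTree.Good.rank_limit_ne_succ {f : ℕ → RawTree} (h : (RawTree.limit f).Good)
    (a : Ordinal) : (RawTree.limit f).rank ≠ Order.succ a := by
  intro ha
  obtain ⟨k, hk⟩ := RawTree.lt_rank_limit (ha ▸ Order.lt_succ a)
  exact ((Order.succ_le_of_lt hk).trans_lt (h.rank_lt_rank_limit k)).ne' ha

/-- The delicate case is a successor below a limit: `rank x` lies strictly below a supremum, hence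
below some term, and the inner induction on `y` descends to that term. -/
theorem RawTree.Good.le_of_rank_le {x y : RawTree} (hx : x.Good) (hy : y.Good)
    (h : x.rank ≤ y.rank) : RawTree.Le x y := by
  induction x generalizing y with
  | zero => exact RawTree.Le.zero hy
  | succ x ihx =>
    induction y with
    | zero => exact absurd h (Order.succ_le_iff.not.2 not_lt_zero)
    | succ y _ =>
      exact RawTree.Le.succ_mono (ihx hx.of_succ hy.of_succ (Order.succ_le_succ_iff.1 h))
    | limit g ihy =>
      obtain ⟨k, hk⟩ := RawTree.lt_rank_limit (Order.succ_le_iff.1 h)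
      exact RawTree.Le.cocone k hy (ihy k (hy.of_limit k) (Order.succ_le_of_lt hk))
  | limit f ih =>
    exact RawTree.Le.limiting hx fun k =>
      ih k (hx.of_limit k) hy ((RawTree.rank_le_rank_limit f k).trans h)

-- Equality of ranks and the generated equivalence

namespace PreBrw

theorem le_iff_rank_le {x y : PreBrw} : le x y ↔ x.1.rank ≤ y.1.rank :=
  ⟨RawTree.Le.rank_le, x.2.le_of_rank_le y.2⟩

/-- Each term of `f` is strictly below its supremum, hence strictly below that of `g`, so some term
of `g` exceeds it. -/
theorem simulated_of_rank_limit_le {f g : IncSeq lt}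
    (h : (limit f).1.rank ≤ (limit g).1.rank) : Simulated le f.1 g.1 := fun k => by
  obtain ⟨n, hn⟩ := RawTree.lt_rank_limit (((limit f).2.rank_lt_rank_limit k).trans_le h)
  exact ⟨n, le_iff_rank_le.2 hn.le⟩

theorem eqv_of_rank_eq {x y : PreBrw} (h : x.1.rank = y.1.rank) : Eqv x y := by
  obtain ⟨x, hx⟩ := x
  obtain ⟨y, hy⟩ := y
  induction x generalizing y with
  | zero =>
    cases y with
    | zero => exact Eqv.refl _
    | succ y => exact absurd h.symm (Order.succ_ne_bot _)
    | limit g => exact absurd h.symm hy.rank_limit_ne_zero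
  | succ x ih =>
    cases y with
    | zero => exact absurd h (Order.succ_ne_bot _)
    | succ y =>
      exact Eqv.succ_congr (ih hx.of_succ y hy.of_succ (Order.succ_injective h))
    | limit g => exact absurd h.symm (hy.rank_limit_ne_succ _)
  -- No induction hypothesis is needed: `bisim` asks only for `≤` between terms, which ranks decide.
  | limit f _ =>
    cases y with
    | zero => exact absurd h hx.rank_limit_ne_zero
    | succ y => exact absurd h (hx.rank_limit_ne_succ _)
    | limit g =>
      cases hx with
      | limit hf hfi =>
        cases hy with
        | limit hg hgi =>
          let F : IncSeq lt := ⟨fun k => ⟨f k, hf k⟩, hfi⟩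
          let G : IncSeq lt := ⟨fun k => ⟨g k, hg k⟩, hgi⟩
          exact Eqv.bisim F G
            ⟨simulated_of_rank_limit_le (f := F) (g := G) h.le,
              simulated_of_rank_limit_le (f := G) (g := F) h.ge⟩

end PreBrw

-- Transfer to the quotient

namespace Brw

/-- The ordinal denoted by a Brouwer tree. -/
noncomputable def rank : Brw → Ordinal.{0} :=
  Quotient.lift (fun x : PreBrw => x.1.rank) fun _ _ h =>
    (PreBrw.le_iff_rank_le.1 h.le_and_ge.1).antisymm (PreBrw.le_iff_rank_le.1 h.le_and_ge.2)

theorem le_iff_rank_le {x y : Brw} : x ≤ y ↔ x.rank ≤ y.rank := by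
  obtain ⟨x⟩ := x
  obtain ⟨y⟩ := y
  exact PreBrw.le_iff_rank_le

theorem rank_succ (x : Brw) : (succ x).rank = Order.succ x.rank := by
  obtain ⟨x⟩ := x
  rfl

theorem lt_iff_rank_lt {x y : Brw} : x < y ↔ x.rank < y.rank := by
  change succ x ≤ y ↔ _
  rw [le_iff_rank_le, rank_succ, Order.succ_le_iff]

theorem rank_injective : Function.Injective rank := by
  rintro ⟨x⟩ ⟨y⟩ h
  exact Quotient.sound (PreBrw.eqv_of_rank_eq h)

theorem le_antisymm (x y : Brw) (h₁ : x ≤ y) (h₂ : y ≤ x) : x = y :=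
  rank_injective ((le_iff_rank_le.1 h₁).antisymm (le_iff_rank_le.1 h₂))

theorem extensionalRel_lt : ExtensionalRel (fun x y : Brw => x < y) := by
  intro x y h
  simp only [lt_iff_rank_lt] at h
  -- Ranks being linearly ordered, `x` and `y` themselves serve as test elements: if one were below
  -- the other, the hypothesis would put it below itself.
  exact rank_injective (_root_.le_antisymm
    (not_lt.1 fun hlt => lt_irrefl _ ((h y).1 hlt))
    (not_lt.1 fun hlt => lt_irrefl _ ((h x).2 hlt)))

theorem wellFounded_lt : WellFounded (fun x y : Brw => x < y) :=
  Subrelation.wf lt_iff_rank_lt.1 (InvImage.wf rank Ordinal.lt_wf)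

theorem ordinalAxioms : OrdinalAxioms (fun x y : Brw => x < y) (fun x y : Brw => x ≤ y) where
  lt_trans _ _ _ h₁ h₂ := lt_iff_rank_lt.2 ((lt_iff_rank_lt.1 h₁).trans (lt_iff_rank_lt.1 h₂))
  lt_irrefl _ h := lt_irrefl _ (lt_iff_rank_lt.1 h)
  le_refl _ := le_iff_rank_le.2 le_rfl
  le_trans _ _ _ h₁ h₂ := le_iff_rank_le.2 ((le_iff_rank_le.1 h₁).trans (le_iff_rank_le.1 h₂))
  le_antisymm := le_antisymm
  le_of_lt _ _ h := le_iff_rank_le.2 (lt_iff_rank_lt.1 h).le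
  lt_of_lt_of_le _ _ _ h₁ h₂ :=
    lt_iff_rank_lt.2 ((lt_iff_rank_lt.1 h₁).trans_le (le_iff_rank_le.1 h₂))

theorem lt_of_le_of_lt (x y z : Brw) (h₁ : x ≤ y) (h₂ : y < z) : x < z :=
  lt_iff_rank_lt.2 ((le_iff_rank_le.1 h₁).trans_lt (lt_iff_rank_lt.1 h₂))

end Brw

theorem theorem38 :
    (∀ x y : Brw, x ≤ y → y ≤ x → x = y) ∧
    ExtensionalRel (fun x y : Brw => x < y) ∧
    WellFounded (fun x y : Brw => x < y) ∧
    OrdinalAxioms (fun x y : Brw => x < y) (fun x y : Brw => x ≤ y) ∧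
    (∀ x y z : Brw, x ≤ y → y < z → x < z) :=
  ⟨Brw.le_antisymm, Brw.extensionalRel_lt, Brw.wellFounded_lt, Brw.ordinalAxioms,
    Brw.lt_of_le_of_lt⟩
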